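/- Let $(R,\mathfrak m)$ be a Cohen–Macaulay (Noetherian) local ring of dimension $d\ge 3$ with infinite residue field, and let $I$ be an $\mathfrak m$-primary ideal of $R$. Let $\operatorname{gr}(I)=\bigoplus_{n\ge 0} I^n/I^{n+1}$ be the associated graded ring, and let $\operatorname{depth}\operatorname{gr}(I)$ denote its depth with respect to the homogeneous maximal ideal $\mathfrak m/I\oplus\bigoplus_{n\ge1}I^n/I^{n+1}$, that is, the supremum of the lengths of regular sequences contained in that ideal. For $n\in\mathbb Z$ let $H_I(n)=\lambda(R/I^n)$ (length, with $I^n=R$ for $n\le 0$), let $P_I\in\mathbb Q[X]$ be the Hilbert–Samuel polynomial, i.e. the polynomial with $P_I(n)=H_I(n)$ for all $n\gg0$, and let $$\operatorname{n}(I)=\min\{n\in\mathbb Z : P_I(t)=H_I(t)\text{ for all integers } t>n\}$$ be the postulation number of $I$. A reduction of $I$ is an ideal $J\subseteq I$ with $JI^n=I^{n+1}$ for some $n\ge 0$; the smallest such $n$ is denoted $\operatorname{rd}_J(I)$. A reduction is minimal if it is minimal with respect to inclusion among all reductions of $I$, and the reduction number of $I$ is $$\operatorname{rd}(I)=\min\{\operatorname{rd}_J(I):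 J \text{ is a minimal reduction of } I\}.$$ Suppose that $\operatorname{depth}\operatorname{gr}(I)=d-2$. If $\operatorname{n}(I)<-(d-3)$, then $\operatorname{rd}(I)\ge \operatorname{n}(I)+d$. -/

import Mathlib

open IsLocalRing Polynomial

noncomputable section

/-- The depth (grade) of a commutative ring `A` in an ideal `𝔞`: the supremum of the lengths of the
`A`-regular sequences consisting of elements of `𝔞`. -/
def depthIn {A : Type*} [CommRing A] (𝔞 : Ideal A) : ℕ∞ :=
  ⨆ rs ∈ {rs : List A | (∀ r ∈ rs, r ∈ 𝔞) ∧ RingTheory.Sequence.IsRegular A rs}, (rs.length : ℕ∞)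

/-- A Noetherian local ring is Cohen–Macaulay if its depth (in the maximal ideal) equals its Krull
dimension. -/
structure IsCohenMacaulayLocalRing (R : Type*) [CommRing R] [IsLocalRing R] : Prop where
  isNoetherianRing : IsNoetherianRing R
  depth_eq_dim : ((depthIn (maximalIdeal R) : ℕ∞) : WithBot ℕ∞) = ringKrullDim R

/-- `I` is `𝔪`-primary: a primary ideal whose radical is the maximal ideal `𝔪`. -/
def IsMaximalPrimary {R : Type*} [CommRing R] [IsLocalRing R] (I : Ideal R) : Prop :=
  I.IsPrimary ∧ I.radical = maximalIdeal R

/-! ### The associated graded ring -/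

/-- The ideal `⨁ₙ Iⁿ⁺¹ tⁿ` of the Rees algebra `⨁ₙ Iⁿ tⁿ`. -/
def reesShift {R : Type*} [CommRing R] (I : Ideal R) : Ideal (reesAlgebra I) where
  carrier := {f | ∀ n, (f : R[X]).coeff n ∈ I ^ (n + 1)}
  add_mem' hf hg n := by
    simpa using Ideal.add_mem _ (hf n) (hg n)
  zero_mem' n := by simp
  smul_mem' c f hf n := by
    simp only [smul_eq_mul, MulMemClass.coe_mul, coeff_mul]
    refine Ideal.sum_mem _ ?_
    rintro ⟨j, k⟩ e
    rw [← Finset.HasAntidiagonal.mem_antidiagonal.mp e, add_assoc, pow_add]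
    exact Ideal.mul_mem_mul (c.2 j) (hf k)

/-- The associated graded ring `gr(I) = ⨁ₙ Iⁿ / Iⁿ⁺¹`, as the quotient of the Rees algebra
`⨁ₙ Iⁿ tⁿ` by its ideal `⨁ₙ Iⁿ⁺¹ tⁿ`. -/
abbrev AssocGraded {R : Type*} [CommRing R] (I : Ideal R) : Type _ :=
  reesAlgebra I ⧸ reesShift I

/-- The ideal `𝔪 ⊕ ⨁_{n ≥ 1} Iⁿ tⁿ` of the Rees algebra of an ideal of a local ring. -/
def reesMaximalIdeal {R : Type*} [CommRing R] [IsLocalRing R] (I : Ideal R) :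
    Ideal (reesAlgebra I) :=
  (maximalIdeal R).comap ((constantCoeff (R := R)).comp (reesAlgebra I).val.toRingHom)

/-- The depth of `gr(I)`, taken in its homogeneous maximal ideal
`𝔪/I ⊕ ⨁_{n ≥ 1} Iⁿ / Iⁿ⁺¹`. -/
def depthGr {R : Type*} [CommRing R] [IsLocalRing R] (I : Ideal R) : ℕ∞ :=
  depthIn (A := AssocGraded I) ((reesMaximalIdeal I).map (Ideal.Quotient.mk (reesShift I)))

/-! ### Reductions and reduction numbers -/

/-- `J` is a reduction of `I`: `J ⊆ I` and `J Iⁿ = Iⁿ⁺¹` for some natural number `n`. -/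
def IsReduction {R : Type*} [CommRing R] (J I : Ideal R) : Prop :=
  J ≤ I ∧ ∃ n : ℕ, J * I ^ n = I ^ (n + 1)

/-- `J` is a minimal reduction of `I`: minimal for inclusion among the reductions of `I`. -/
def IsMinimalReduction {R : Type*} [CommRing R] (J I : Ideal R) : Prop :=
  Minimal (fun K : Ideal R => IsReduction K I) J

/-- The reduction number `rd_J(I)`: the smallest `n` such that `J Iⁿ = Iⁿ⁺¹`. -/
def reductionNumberWrt {R : Type*} [CommRing R] (J I : Ideal R) : ℕ :=
  sInf {n : ℕ | J * I ^ n = I ^ (n + 1)}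

/-- The reduction number `rd(I)`: the minimum of `rd_J(I)` over all minimal reductions `J`. -/
def reductionNumber {R : Type*} [CommRing R] (I : Ideal R) : ℕ :=
  sInf {r : ℕ | ∃ J : Ideal R, IsMinimalReduction J I ∧ r = reductionNumberWrt J I}

/-! ### Hilbert–Samuel function and postulation number -/

/-- The Hilbert–Samuel function `H_I(n) = λ(R/Iⁿ)` for `n ∈ ℤ`, where `Iⁿ = R` for `n ≤ 0`
(so that `H_I(n) = 0` there). -/
def hilbertSamuelFunction {R : Type*} [CommRing R] (I : Ideal R) (n : ℤ) : ℕ :=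
  (Module.length R (R ⧸ I ^ n.toNat)).toNat

/-- `P` is a Hilbert–Samuel polynomial of `I`: `P(n) = H_I(n)` for all large `n`.
There is at most one such `P`. -/
def IsHilbertSamuelPolynomial {R : Type*} [CommRing R] (I : Ideal R) (P : ℚ[X]) : Prop :=
  ∃ N : ℤ, ∀ n : ℤ, N ≤ n → P.eval (n : ℚ) = (hilbertSamuelFunction I n : ℚ)

open Classical in
/-- The Hilbert–Samuel polynomial `P_I`. It exists when `R` is Noetherian local and `I` is
`𝔪`-primary (Samuel); the value is `0` when there is none. -/
def hilbertSamuelPolynomial {R : Type*} [CommRing R] (I : Ideal R) : ℚ[X] :=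
  if h : ∃ P : ℚ[X], IsHilbertSamuelPolynomial I P then h.choose else 0

/-- The postulation number `n(I) = min {n ∈ ℤ : P_I(t) = H_I(t) for all t > n}`. If `dim R > 0`
and `I` is `𝔪`-primary, this set is nonempty and bounded below, so that the infimum in `ℤ` is a
minimum. -/
def postulationNumber {R : Type*} [CommRing R] (I : Ideal R) : ℤ :=
  sInf {n : ℤ | ∀ t : ℤ, n < t →
    (hilbertSamuelPolynomial I).eval (t : ℚ) = (hilbertSamuelFunction I t : ℚ)}

end

/-!
The hypothesis on the postulation number says that `n(I) + d ≤ 2`, so a counterexample would have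
`rd(I) ≤ 1`, that is, a minimal reduction `J` with `J I = I²`. As `R` is Cohen–Macaulay with
infinite residue field, superficial elements produce an `R`-regular sequence of length `d` that
generates `J`. Since `J I = I²`, it satisfies `J ∩ Iⁿ⁺¹ = J Iⁿ` for all `n`, so by Valabrega and
Valla its initial forms are a regular sequence in `gr(I)`. Hence `depth gr(I) ≥ d`, a contradiction.
-/

/-! ### Minimal reductions -/

theorem IsReduction.refl {R : Type*} [CommRing R] (I : Ideal R) : IsReduction I I :=
  ⟨le_rfl, 0, by simp⟩

theorem IsReduction.trans {R : Type*} [CommRing R] {K J I : Ideal R} (hK : IsReduction K J)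
    (hJ : IsReduction J I) : IsReduction K I := by
  obtain ⟨hKJ, m, hm⟩ := hK
  obtain ⟨hJI, n, hn⟩ := hJ
  have hpow : ∀ k, J ^ k * I ^ n = I ^ (n + k) := by
    intro k
    induction k with
    | zero => simp
    | succ k ih => rw [pow_succ', mul_assoc, ih, pow_add, ← mul_assoc, hn, ← pow_add]; ring_nf
  refine ⟨hKJ.trans hJI, n + m, ?_⟩
  rw [← hpow m, ← mul_assoc, hm, hpow, add_assoc]

theorem IsReduction.mul_pow_eq_of_reductionNumberWrt_le {R : Type*} [CommRing R] {J I : Ideal R}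
    (h : IsReduction J I) {n : ℕ} (hn : reductionNumberWrt J I ≤ n) : J * I ^ n = I ^ (n + 1) := by
  obtain ⟨k, rfl⟩ := Nat.exists_eq_add_of_le hn
  have hmem : J * I ^ reductionNumberWrt J I = I ^ (reductionNumberWrt J I + 1) := Nat.sInf_mem h.2
  rw [pow_add, ← mul_assoc, hmem]
  ring

theorem IsReduction.radical_eq {R : Type*} [CommRing R] {J I : Ideal R} (h : IsReduction J I) :
    J.radical = I.radical := by
  obtain ⟨hle, n, hn⟩ := h
  refine le_antisymm (Ideal.radical_mono hle) ?_
  rw [← Ideal.radical_pow I n.succ_ne_zero, ← hn]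
  exact Ideal.radical_mono Ideal.mul_le_left

theorem IsReduction.of_le_sup {R : Type*} [CommRing R] [IsLocalRing R] [IsNoetherianRing R]
    {J K I : Ideal R} (hJ : IsReduction J I) (hKI : K ≤ I) (h : J ≤ K ⊔ maximalIdeal R * I) :
    IsReduction K I := by
  obtain ⟨-, n, hn⟩ := hJ
  refine ⟨hKI, n, le_antisymm ((Ideal.mul_mono_left hKI).trans (pow_succ' I n).ge) ?_⟩
  refine Submodule.le_of_le_smul_of_le_jacobson_bot (I := maximalIdeal R)
    (IsNoetherian.noetherian _) (maximalIdeal_le_jacobson ⊥) ?_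
  calc I ^ (n + 1) = J * I ^ n := hn.symm
    _ ≤ (K ⊔ maximalIdeal R * I) * I ^ n := Ideal.mul_mono_left h
    _ = K * I ^ n ⊔ maximalIdeal R • I ^ (n + 1) := by
      rw [Ideal.sup_mul, mul_assoc, ← pow_succ', smul_eq_mul]

theorem span_inf_le_smul_span_of_forall_notMem {R : Type*} [CommRing R] [IsLocalRing R]
    {M : Type*} [AddCommGroup M] [Module R M] [DecidableEq M] {S : Finset M} {N : Submodule R M}
    (hS : ∀ s ∈ S, s ∉ Submodule.span R (S.erase s : Set M) ⊔ N) :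
    Submodule.span R (S : Set M) ⊓ N ≤ maximalIdeal R • Submodule.span R (S : Set M) := by
  rintro a ⟨haS, haN⟩
  obtain ⟨f, -, rfl⟩ := Submodule.mem_span_finset.mp haS
  refine Submodule.sum_mem _ fun s hs => ?_
  suffices hf : f s ∈ maximalIdeal R from Submodule.smul_mem_smul hf (Submodule.subset_span hs)
  by_contra hf
  have hunit : IsUnit (f s) := by simpa using hf
  have hrest : ∑ t ∈ S.erase s, f t • t ∈ Submodule.span R (S.erase s : Set M) :=
    Submodule.sum_mem _ fun t ht => Submodule.smul_mem _ _ (Submodule.subset_span ht)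
  refine hS s hs ((Submodule.smul_mem_iff_of_isUnit _ hunit).mp ?_)
  rw [← add_sub_cancel_right (f s • s) (∑ t ∈ S.erase s, f t • t),
    Finset.add_sum_erase S (fun t => f t • t) hs]
  exact Submodule.sub_mem _ (Submodule.mem_sup_right haN) (Submodule.mem_sup_left hrest)

theorem exists_le_sup_and_inf_le_maximalIdeal_smul {R : Type*} [CommRing R] [IsLocalRing R]
    {M : Type*} [AddCommGroup M] [Module R M] {L : Submodule R M} (hL : L.FG)
    (N : Submodule R M) : ∃ K ≤ L, L ≤ K ⊔ N ∧ K ⊓ N ≤ maximalIdeal R • K := by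
  classical
  have hex : ∃ S : Finset M, Submodule.span R (S : Set M) ≤ L ∧
      L ≤ Submodule.span R (S : Set M) ⊔ N := by
    obtain ⟨S, rfl⟩ := hL
    exact ⟨S, le_rfl, le_sup_left⟩
  obtain ⟨S, ⟨hSL, hLS⟩, hmin⟩ := exists_minimal_of_wellFoundedLT _ hex
  refine ⟨_, hSL, hLS, span_inf_le_smul_span_of_forall_notMem fun s hs hmem => ?_⟩
  have hle : Submodule.span R (S : Set M) ≤ Submodule.span R (S.erase s : Set M) ⊔ N := by
    rw [← Finset.insert_erase hs, Finset.coe_insert, Submodule.span_insert, Finset.insert_erase hs]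
    exact sup_le ((Submodule.span_singleton_le_iff_mem _ _).mpr hmem) le_sup_left
  have herase : Submodule.span R (S.erase s : Set M) ≤ Submodule.span R (S : Set M) :=
    Submodule.span_mono (Finset.coe_subset.mpr (S.erase_subset s))
  exact Finset.notMem_erase s S
    (hmin ⟨herase.trans hSL, hLS.trans (sup_le hle le_sup_right)⟩ (S.erase_subset s) hs)

theorem isArtinian_quotient_maximalIdeal_smul_top (R : Type*) [CommRing R] [IsLocalRing R]
    (M : Type*) [AddCommGroup M] [Module R M] [Module.Finite R M] :
    IsArtinian R (M ⧸ (maximalIdeal R • ⊤ : Submodule R M)) := by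
  let : Field (R ⧸ maximalIdeal R) := Ideal.Quotient.field _
  have : Module.Finite (R ⧸ maximalIdeal R) (M ⧸ (maximalIdeal R • ⊤ : Submodule R M)) :=
    Module.Finite.of_restrictScalars_finite R _ _
  exact isArtinian_of_surjective_algebraMap (R := R ⧸ maximalIdeal R)
    Ideal.Quotient.mk_surjective

-- `J` is chosen with minimal image in the Artinian module `I / 𝔪 I`.
theorem exists_isReduction_forall_le_sup {R : Type*} [CommRing R] [IsLocalRing R]
    [IsNoetherianRing R] (I : Ideal R) : ∃ J, IsReduction J I ∧
      ∀ K ≤ J, IsReduction K I → J ≤ K ⊔ maximalIdeal R * I := by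
  have := isArtinian_quotient_maximalIdeal_smul_top R I
  let fiber : Ideal R → Submodule R (I ⧸ (maximalIdeal R • ⊤ : Submodule R I)) :=
    fun K => (Submodule.comap I.subtype K).map (Submodule.mkQ _)
  obtain ⟨J, hJ, hmin⟩ := (InvImage.wf fiber wellFounded_lt).has_min {J | IsReduction J I}
    ⟨I, .refl I⟩
  refine ⟨J, hJ, fun K hKJ hK => ?_⟩
  have hle : fiber J ≤ fiber K := by
    by_contra hnle
    exact hmin K hK ⟨Submodule.map_mono (Submodule.comap_mono hKJ), hnle⟩
  rw [Submodule.map_le_iff_le_comap, Submodule.comap_map_mkQ] at hle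
  have hmap := Submodule.map_mono (f := I.subtype) hle
  rwa [Submodule.map_sup, Submodule.map_comap_subtype, Submodule.map_comap_subtype,
    Submodule.map_smul'', Submodule.map_top, Submodule.range_subtype, inf_eq_right.mpr hJ.1,
    inf_eq_right.mpr hK.1, sup_comm] at hmap

theorem exists_isMinimalReduction {R : Type*} [CommRing R] [IsLocalRing R] [IsNoetherianRing R]
    (I : Ideal R) : ∃ J, IsMinimalReduction J I := by
  obtain ⟨J₀, hJ₀, hmin⟩ := exists_isReduction_forall_le_sup I
  obtain ⟨J, hJJ₀, hJ₀J, hJ⟩ := exists_le_sup_and_inf_le_maximalIdeal_smul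
    (IsNoetherian.noetherian J₀) (maximalIdeal R * I)
  refine ⟨J, hJ₀.of_le_sup (hJJ₀.trans hJ₀.1) hJ₀J, fun K hK hKJ => ?_⟩
  refine Submodule.le_of_le_smul_of_le_jacobson_bot (I := maximalIdeal R)
    (IsNoetherian.noetherian _) (maximalIdeal_le_jacobson ⊥) ?_
  calc J ≤ (K ⊔ maximalIdeal R * I) ⊓ J :=
        le_inf (hJJ₀.trans (hmin K (hKJ.trans hJJ₀) hK)) le_rfl
    _ = K ⊔ J ⊓ maximalIdeal R * I := by rw [sup_inf_assoc_of_le _ hKJ, inf_comm]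
    _ ≤ K ⊔ maximalIdeal R • J := sup_le_sup_left hJ _

theorem exists_isMinimalReduction_reductionNumber_eq {R : Type*} [CommRing R] [IsLocalRing R]
    [IsNoetherianRing R] (I : Ideal R) :
    ∃ J, IsMinimalReduction J I ∧ reductionNumber I = reductionNumberWrt J I := by
  obtain ⟨J, hJ⟩ := exists_isMinimalReduction I
  exact Nat.sInf_mem
    (s := {r | ∃ J : Ideal R, IsMinimalReduction J I ∧ r = reductionNumberWrt J I}) ⟨_, J, hJ, rfl⟩

/-! ### Superficial elements -/

theorem infinite_of_nontrivial_module (R M : Type*) [CommRing R] [IsLocalRing R]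
    [Infinite (ResidueField R)] [AddCommGroup M] [Module R M] [Nontrivial M] : Infinite M := by
  obtain ⟨m, hm⟩ := exists_ne (0 : M)
  let lift : ResidueField R → R := Function.surjInv residue_surjective
  refine Infinite.of_injective (fun a => lift a • m) fun a b hab => ?_
  by_contra hne
  have hunit : IsUnit (lift a - lift b) := by
    rw [← residue_ne_zero_iff_isUnit, map_sub, Function.surjInv_eq residue_surjective a,
      Function.surjInv_eq residue_surjective b]
    exact sub_ne_zero.mpr hne
  exact hm (hunit.smul_eq_zero.mp (by rw [sub_smul]; exact sub_eq_zero.mpr hab))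

theorem exists_forall_notMem_of_forall_ne_top {R M ι : Type*} [CommRing R] [IsLocalRing R]
    [Infinite (ResidueField R)] [AddCommGroup M] [Module R M] {s : Finset ι}
    {W : ι → Submodule R M} (hW : ∀ i ∈ s, W i ≠ ⊤) : ∃ x, ∀ i ∈ s, x ∉ W i := by
  by_contra! hcover
  obtain ⟨i, hi, _⟩ := Submodule.exists_finiteIndex_of_cover (p := W) (s := s)
    (Set.eq_univ_of_forall fun x => by simpa using hcover x)
  have : Finite (M ⧸ W i) := AddSubgroup.finite_quotient_of_finiteIndex
  have : Nontrivial (M ⧸ W i) := Submodule.Quotient.nontrivial_iff.mpr (hW i hi)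
  have : Infinite (M ⧸ W i) := infinite_of_nontrivial_module R _
  exact not_finite (M ⧸ W i)

section Rees

variable {R : Type*} [CommRing R] {I : Ideal R}

/-- The inclusion of an ideal `I` as the degree one component `I t` of its Rees algebra. -/
noncomputable def reesDegreeOne (I : Ideal R) : I →ₗ[R] reesAlgebra I where
  toFun x := ⟨monomial 1 (x : R), reesAlgebra.monomial_mem.mpr (by simp)⟩
  map_add' x y := Subtype.ext (by simp)
  map_smul' r x := Subtype.ext (by simp [smul_monomial])

theorem coe_reesDegreeOne (x : I) : (reesDegreeOne I x : R[X]) = monomial 1 (x : R) := rfl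

/-- The degree `n` piece of an ideal `T` of the Rees algebra of `I`: the ideal of all `a` such that
`a tⁿ` lies in `T`. -/
noncomputable def reesPiece (T : Ideal (reesAlgebra I)) (n : ℕ) : Ideal R :=
  ((T.restrictScalars R).map (reesAlgebra I).val.toLinearMap).comap (monomial n)

theorem mem_reesPiece {T : Ideal (reesAlgebra I)} {n : ℕ} {a : R} :
    a ∈ reesPiece T n ↔ ∃ f ∈ T, (f : R[X]) = monomial n a := Iff.rfl

theorem coe_eq_monomial_mem_iff {T : Ideal (reesAlgebra I)} {n : ℕ} {a : R} {f : reesAlgebra I}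
    (hf : (f : R[X]) = monomial n a) : f ∈ T ↔ a ∈ reesPiece T n := by
  refine ⟨fun h => ⟨f, h, hf⟩, ?_⟩
  rintro ⟨g, hg, hga⟩
  rwa [Subtype.ext (hf.trans hga.symm)]

theorem reesPiece_mul_reesPiece_le (S T : Ideal (reesAlgebra I)) (m n : ℕ) :
    reesPiece S m * reesPiece T n ≤ reesPiece (S * T) (m + n) := by
  refine Ideal.mul_le.mpr ?_
  rintro a ⟨f, hf, hfa⟩ b ⟨g, hg, hgb⟩
  refine mem_reesPiece.mpr ⟨f * g, Ideal.mul_mem_mul hf hg, ?_⟩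
  rw [← monomial_mul_monomial]
  exact congrArg₂ (· * ·) hfa hgb

theorem reesPiece_mono {S T : Ideal (reesAlgebra I)} (h : S ≤ T) (n : ℕ) :
    reesPiece S n ≤ reesPiece T n :=
  Submodule.comap_mono (Submodule.map_mono h)

theorem pow_le_reesPiece_top (I : Ideal R) (n : ℕ) :
    I ^ n ≤ reesPiece (⊤ : Ideal (reesAlgebra I)) n :=
  fun a ha => ⟨⟨monomial n a, reesAlgebra.monomial_mem.mpr ha⟩, trivial, rfl⟩

theorem reesPiece_mul_pow_le (T : Ideal (reesAlgebra I)) (m n : ℕ) :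
    reesPiece T m * I ^ n ≤ reesPiece T (m + n) :=
  (Ideal.mul_mono_right (pow_le_reesPiece_top I n)).trans <|
    (reesPiece_mul_reesPiece_le T ⊤ m n).trans (reesPiece_mono Ideal.mul_le_left _)

theorem pow_le_reesPiece_span_reesDegreeOne_pow (I : Ideal R) (n : ℕ) :
    I ^ n ≤ reesPiece (Ideal.span (Set.range (reesDegreeOne I)) ^ n) n := by
  induction n with
  | zero => simpa using pow_le_reesPiece_top I 0
  | succ n ih =>
    have hone : I ≤ reesPiece (Ideal.span (Set.range (reesDegreeOne I))) 1 := fun a ha =>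
      ⟨reesDegreeOne I ⟨a, ha⟩, Ideal.subset_span ⟨_, rfl⟩, rfl⟩
    rw [pow_succ, pow_succ]
    exact (Ideal.mul_mono ih hone).trans (reesPiece_mul_reesPiece_le _ _ n 1)

theorem reesPiece_reesShift (I : Ideal R) (n : ℕ) : reesPiece (reesShift I) n = I ^ (n + 1) := by
  refine le_antisymm ?_ fun a ha => ?_
  · rintro a ⟨f, hf, hfa⟩
    have hcoeff : (f : R[X]).coeff n = a := by
      rw [show (f : R[X]) = monomial n a from hfa, coeff_monomial_same]
    exact hcoeff ▸ hf n
  · obtain ⟨f, -, hfa⟩ := pow_le_reesPiece_top I n (Ideal.pow_le_pow_right n.le_succ ha)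
    refine mem_reesPiece.mpr ⟨f, fun m => ?_, hfa⟩
    rw [show (f : R[X]) = monomial n a from hfa, coeff_monomial]
    split_ifs with h
    · exact h ▸ ha
    · exact zero_mem _

theorem mem_of_forall_coeff_mem_reesPiece {T : Ideal (reesAlgebra I)} {f : reesAlgebra I}
    (hf : ∀ n, (f : R[X]).coeff n ∈ reesPiece T n) : f ∈ T := by
  choose g hgT hg using hf
  have hsum : f = ∑ n ∈ (f : R[X]).support, g n := by
    apply Subtype.ext
    rw [AddSubmonoidClass.coe_finsetSum]
    exact (f : R[X]).as_sum_support.trans (Finset.sum_congr rfl fun n _ => (hg n).symm)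
  exact hsum ▸ Ideal.sum_mem _ fun n _ => hgT n

end Rees

/-- `x` is a superficial element of `I`: `(Iⁿ⁺¹ : x) ∩ I ^ c ⊆ Iⁿ` for some `c` and all `n ≥ c`. -/
def IsSuperficial {R : Type*} [CommRing R] (x : R) (I : Ideal R) : Prop :=
  x ∈ I ∧ ∃ c, ∀ n ≥ c, ∀ a ∈ I ^ c, x * a ∈ I ^ (n + 1) → a ∈ I ^ n

theorem exists_finset_forall_mem_of_mul_mem {A : Type*} [CommRing A] [IsNoetherianRing A]
    (𝔞 𝔟 : Ideal A) : ∃ (s : Finset (Ideal A)) (c : ℕ), (∀ 𝔭 ∈ s, ¬𝔟 ≤ 𝔭) ∧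
      ∀ t, (∀ 𝔭 ∈ s, t ∉ 𝔭) → ∀ f ∈ 𝔟 ^ c, f * t ∈ 𝔞 → f ∈ 𝔞 := by
  classical
  obtain ⟨s, rfl, hprimary⟩ := Submodule.isLasker A A 𝔞
  have hpow : ∀ 𝔮 : Ideal A, ∃ c, 𝔟 ≤ 𝔮.radical → 𝔟 ^ c ≤ 𝔮 := fun 𝔮 => by
    by_cases h : 𝔟 ≤ 𝔮.radical
    · obtain ⟨c, hc⟩ := Ideal.exists_pow_le_of_le_radical_of_fg h (IsNoetherian.noetherian 𝔟)
      exact ⟨c, fun _ => hc⟩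
    · exact ⟨0, fun h' => absurd h' h⟩
  choose c hc using hpow
  refine ⟨(s.filter fun 𝔮 : Ideal A => ¬𝔟 ≤ 𝔮.radical).image Ideal.radical, s.sup c,
    Finset.forall_mem_image.mpr fun 𝔮 h𝔮 => (Finset.mem_filter.mp h𝔮).2, fun t ht f hf hft => ?_⟩
  rw [Submodule.mem_finsetInf] at hft ⊢
  intro 𝔮 h𝔮
  by_cases h : 𝔟 ≤ Ideal.radical 𝔮
  · exact hc 𝔮 h (Ideal.pow_le_pow_right (Finset.le_sup h𝔮) hf)
  · exact ((Ideal.isPrimary_iff.mp (hprimary h𝔮)).2 (hft 𝔮 h𝔮)).resolve_right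
      (ht _ (Finset.mem_image_of_mem _ (Finset.mem_filter.mpr ⟨h𝔮, h⟩)))

section Superficial

variable {R : Type*} [CommRing R] {I : Ideal R}

theorem isSuperficial_of_forall_mul_mem {x : R} (hx : x ∈ I) {c : ℕ}
    (h : ∀ n ≥ c, ∀ a ∈ I ^ n, x * a ∈ I ^ (n + 2) → a ∈ I ^ (n + 1)) : IsSuperficial x I := by
  refine ⟨hx, c, fun n hn a ha => ?_⟩
  induction n, hn using Nat.le_induction with
  | base => exact fun _ => ha
  | succ n hn ih =>
    exact fun hxa => h n hn a (ih (Ideal.pow_le_pow_right (n + 1).le_succ hxa)) hxa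

variable [IsNoetherianRing R]

theorem exists_isSuperficial_forall_notMem [IsLocalRing R] [Infinite (ResidueField R)]
    {s : Finset (Ideal R)} (hs : ∀ 𝔭 ∈ s, ¬I ≤ 𝔭) : ∃ x, IsSuperficial x I ∧ ∀ 𝔭 ∈ s, x ∉ 𝔭 := by
  -- It suffices that `x t` avoids the primes associated with `⨁ₙ Iⁿ⁺¹ tⁿ` not containing `I t`.
  obtain ⟨t, c, ht, hmem⟩ := exists_finset_forall_mem_of_mul_mem (reesShift I)
    (Ideal.span (Set.range (reesDegreeOne I)))
  let W : Ideal R ⊕ Ideal (reesAlgebra I) → Submodule R I :=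
    Sum.elim (Submodule.comap I.subtype)
      fun 𝔓 => (𝔓.restrictScalars R).comap (reesDegreeOne I)
  have hW : ∀ i ∈ s.disjSum t, W i ≠ ⊤ := by
    rintro (𝔭 | 𝔓) hi htop
    · exact hs 𝔭 (Finset.inl_mem_disjSum.mp hi) fun x hx => htop.ge (x := ⟨x, hx⟩) trivial
    · refine ht 𝔓 (Finset.inr_mem_disjSum.mp hi) (Ideal.span_le.mpr ?_)
      rintro _ ⟨x, rfl⟩
      exact htop.ge (x := x) trivial
  obtain ⟨x, hx⟩ := exists_forall_notMem_of_forall_ne_top hW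
  refine ⟨x, isSuperficial_of_forall_mul_mem x.2 (c := c) fun n hn a ha hxa => ?_,
    fun 𝔭 h𝔭 => hx (.inl 𝔭) (Finset.inl_mem_disjSum.mpr h𝔭)⟩
  obtain ⟨f, hf, hfa⟩ := mem_reesPiece.mp (pow_le_reesPiece_span_reesDegreeOne_pow I n ha)
  have hfx : ((f * reesDegreeOne I x : reesAlgebra I) : R[X]) = monomial (n + 1) (x * a) := by
    rw [MulMemClass.coe_mul, hfa, coe_reesDegreeOne, monomial_mul_monomial, mul_comm a]
  rw [← reesPiece_reesShift] at hxa ⊢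
  exact (coe_eq_monomial_mem_iff hfa).mp <| hmem _
    (fun 𝔓 h𝔓 => hx (.inr 𝔓) (Finset.inr_mem_disjSum.mpr h𝔓)) f (Ideal.pow_le_pow_right hn hf)
    ((coe_eq_monomial_mem_iff hfx).mpr hxa)

theorem isSMulRegular_iff_forall_mem_associatedPrimes {x : R} :
    IsSMulRegular R x ↔ ∀ 𝔭 ∈ associatedPrimes R R, x ∉ 𝔭 := by
  have hunion := Set.ext_iff.mp (biUnion_associatedPrimes_eq_compl_regular R R) x
  simpa using (not_congr hunion).symm

theorem exists_isSuperficial_isSMulRegular [IsLocalRing R] [Infinite (ResidueField R)]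
    (hI : ∃ y ∈ I, IsSMulRegular R y) : ∃ x, IsSuperficial x I ∧ IsSMulRegular R x := by
  obtain ⟨y, hyI, hy⟩ := hI
  have hfin := associatedPrimes.finite R R
  obtain ⟨x, hx, hxp⟩ := exists_isSuperficial_forall_notMem (I := I) (s := hfin.toFinset)
    fun 𝔭 h𝔭 hle => isSMulRegular_iff_forall_mem_associatedPrimes.mp hy 𝔭
      (hfin.mem_toFinset.mp h𝔭) (hle hyI)
  exact ⟨x, hx, isSMulRegular_iff_forall_mem_associatedPrimes.mpr fun 𝔭 h𝔭 =>
    hxp 𝔭 (hfin.mem_toFinset.mpr h𝔭)⟩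

theorem IsSuperficial.exists_forall_pow_inf_span_le {x : R} (hx : IsSuperficial x I) :
    ∃ c, ∀ n ≥ c, I ^ (n + 1) ⊓ Ideal.span {x} ≤ Ideal.span {x} * I ^ n := by
  obtain ⟨-, c, hc⟩ := hx
  obtain ⟨k, hk⟩ := Ideal.exists_pow_inf_eq_pow_smul I (Ideal.span {x})
  refine ⟨c + k, fun n hn y hy => ?_⟩
  have hArtinRees : I ^ (n + 1) ⊓ Ideal.span {x} ≤ Ideal.span {x} * I ^ c := by
    have h := hk (n + 1) (by omega)
    rw [smul_eq_mul, Ideal.mul_top] at h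
    rw [h, smul_eq_mul, mul_comm]
    exact Ideal.mul_mono inf_le_right (Ideal.pow_le_pow_right (by omega))
  obtain ⟨a, ha, rfl⟩ := Ideal.mem_span_singleton_mul.mp (hArtinRees hy)
  exact Ideal.mem_span_singleton_mul.mpr ⟨a, hc n (by omega) a ha hy.1, rfl⟩

end Superficial

/-! ### Depth modulo a regular element -/

section Depth

universe u v

open RingTheory.Sequence CategoryTheory Abelian Limits Pointwise

theorem isRegular_take {A M : Type*} [CommRing A] [AddCommGroup M] [Module A M] {rs : List A}
    (h : IsRegular M rs) (n : ℕ) : IsRegular M (rs.take n) := by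
  have hweak := h.toIsWeaklyRegular
  rw [← List.take_append_drop n rs, isWeaklyRegular_append_iff] at hweak
  refine ⟨hweak.1, fun htop => h.top_ne_smul (top_le_iff.mp (htop.le.trans ?_)).symm⟩
  exact Submodule.smul_mono_left (Ideal.span_mono fun r hr => List.mem_of_mem_take hr)

theorem natCast_le_depthIn_iff {A : Type*} [CommRing A] [Nontrivial A] {𝔞 : Ideal A} {n : ℕ} :
    n ≤ depthIn 𝔞 ↔ ∃ rs : List A, rs.length = n ∧ (∀ r ∈ rs, r ∈ 𝔞) ∧ IsRegular A rs := by
  refine ⟨fun h => ?_, ?_⟩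
  · obtain _ | k := n
    · exact ⟨[], rfl, by simp, IsRegular.nil A A⟩
    have hlt : (k : ℕ∞) < depthIn 𝔞 := (Nat.cast_lt.mpr k.lt_succ_self).trans_le h
    simp only [depthIn, lt_iSup_iff, Nat.cast_lt] at hlt
    obtain ⟨rs, ⟨hmem, hreg⟩, hlen⟩ := hlt
    exact ⟨rs.take (k + 1), List.length_take_of_le hlen,
      fun r hr => hmem r (List.mem_of_mem_take hr), isRegular_take hreg _⟩
  · rintro ⟨rs, rfl, h⟩
    exact le_iSup₂_of_le rs h le_rfl

theorem isRegular_cons_iff_quotient_span {A : Type*} [CommRing A] (x : A) (rs : List A) :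
    IsRegular A (x :: rs) ↔ IsSMulRegular A x ∧
      IsRegular (A ⧸ Ideal.span {x}) (rs.map (Ideal.Quotient.mk (Ideal.span {x}))) := by
  have hx : x • (⊤ : Ideal A) = Ideal.span {x} := by
    simp [← Submodule.ideal_span_singleton_smul]
  let e : QuotSMulTop x A ≃ₗ[A] A ⧸ Ideal.span {x} := Submodule.quotEquivOfEq _ _ hx
  rw [isRegular_cons_iff']
  refine and_congr_right fun _ => AddEquiv.isRegular_congr (e := e.toAddEquiv) ?_
  rw [List.forall₂_same]
  intro r _ m
  obtain ⟨r, rfl⟩ := Ideal.Quotient.mk_surjective r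
  exact e.map_smul r m

variable {R : Type u} [CommRing R] [IsLocalRing R] [IsNoetherianRing R]

theorem exists_isRegular_iff_subsingleton_ext [Small.{v} R] (M : Type v) [AddCommGroup M]
    [Module R M] [Module.Finite R M] [Nontrivial M] (n : ℕ) :
    (∃ rs : List R, rs.length = n ∧ (∀ r ∈ rs, r ∈ maximalIdeal R) ∧ IsRegular M rs) ↔
      ∀ i < n, Subsingleton
        (Ext (ModuleCat.of R (Shrink.{v} (R ⧸ maximalIdeal R))) (ModuleCat.of R M) i) :=
  (ModuleCat.exists_isRegular_tfae (maximalIdeal R) n (ModuleCat.of R M)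
    (Submodule.top_ne_ideal_smul_of_le_jacobson_annihilator
      (maximalIdeal_le_jacobson _)).symm.lt_top).out 3 1

theorem exists_isRegular_quotSMulTop [Small.{v} R] {M : Type v} [AddCommGroup M] [Module R M]
    [Module.Finite R M] [Nontrivial M] {n : ℕ} {x : R} (hx : x ∈ maximalIdeal R)
    (hxreg : IsSMulRegular M x)
    (hM : ∃ rs : List R, rs.length = n + 1 ∧ (∀ r ∈ rs, r ∈ maximalIdeal R) ∧ IsRegular M rs) :
    ∃ rs : List R, rs.length = n ∧ (∀ r ∈ rs, r ∈ maximalIdeal R) ∧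
      IsRegular (QuotSMulTop x M) rs := by
  have := nontrivial_quotSMulTop_of_mem_maximalIdeal M hx
  rw [exists_isRegular_iff_subsingleton_ext] at hM ⊢
  intro i hi
  have hexact := Ext.covariant_sequence_exact₃' (ModuleCat.of R (Shrink.{v} (R ⧸ maximalIdeal R)))
    (IsSMulRegular.smulShortComplex_shortExact (M := ModuleCat.of R M) hxreg) i (i + 1) rfl
  have hleft := AddCommGrpCat.isZero_of_iff_subsingleton.mpr (hM i (by omega))
  have hright := AddCommGrpCat.isZero_of_iff_subsingleton.mpr (hM (i + 1) (by omega))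
  exact AddCommGrpCat.subsingleton_of_isZero
    (hexact.isZero_of_both_zeros (hleft.eq_zero_of_src _) (hright.eq_zero_of_tgt _))

theorem natCast_le_depthIn_quotient_span_singleton {x : R} [IsLocalRing (R ⧸ Ideal.span {x})]
    (hx : x ∈ maximalIdeal R) (hxreg : IsSMulRegular R x) {n : ℕ}
    (hn : (n + 1 : ℕ) ≤ depthIn (maximalIdeal R)) :
    n ≤ depthIn (maximalIdeal (R ⧸ Ideal.span {x})) := by
  rw [natCast_le_depthIn_iff] at hn
  obtain ⟨rs, hlen, hmem, hreg⟩ := exists_isRegular_quotSMulTop hx hxreg hn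
  have hπ : Function.Surjective (Ideal.Quotient.mk (Ideal.span {x})) :=
    Ideal.Quotient.mk_surjective
  refine natCast_le_depthIn_iff.mpr ⟨rs.map (Ideal.Quotient.mk _), by simpa using hlen, ?_,
    ((isRegular_cons_iff_quotient_span x rs).mp ((isRegular_cons_iff R x rs).mpr
      ⟨hxreg, hreg⟩)).2⟩
  rw [List.forall_mem_map, ← map_maximalIdeal_of_surjective _ hπ]
  exact fun r hr => Ideal.mem_map_of_mem _ (hmem r hr)

theorem depthIn_maximalIdeal_le_ringKrullDim (R : Type*) [CommRing R] [IsLocalRing R]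
    [IsNoetherianRing R] :
    ((depthIn (maximalIdeal R) : ℕ∞) : WithBot ℕ∞) ≤ ringKrullDim R := by
  obtain ⟨d, hd⟩ : ∃ d : ℕ, ringKrullDim R = d :=
    ⟨_, Order.krullDim_eq_length_of_finiteDimensionalOrder⟩
  suffices h : depthIn (maximalIdeal R) ≤ d from hd ▸ WithBot.coe_le_coe.mpr h
  refine iSup₂_le fun rs ⟨_, hreg⟩ => ?_
  have : Nontrivial (R ⧸ Ideal.ofList rs) := by
    simpa [Ideal.Quotient.nontrivial_iff] using hreg.top_ne_smul.symm
  have hle : (rs.length : WithBot ℕ∞) ≤ ringKrullDim R := by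
    rw [← ringKrullDim_add_length_eq_ringKrullDim_of_isRegular rs hreg]
    exact le_add_of_nonneg_left ringKrullDim_nonneg_of_nontrivial
  exact WithBot.coe_le_coe.mp (hle.trans hd.le)

theorem IsCohenMacaulayLocalRing.quotient_span_singleton {R : Type*} [CommRing R] [IsLocalRing R]
    (hR : IsCohenMacaulayLocalRing R) {x : R} [IsLocalRing (R ⧸ Ideal.span {x})]
    (hx : x ∈ maximalIdeal R) (hxreg : IsSMulRegular R x) :
    IsCohenMacaulayLocalRing (R ⧸ Ideal.span {x}) := by
  have := hR.isNoetherianRing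
  refine ⟨inferInstance, le_antisymm (depthIn_maximalIdeal_le_ringKrullDim _) ?_⟩
  obtain ⟨e, he⟩ : ∃ e : ℕ, ringKrullDim (R ⧸ Ideal.span {x}) = e :=
    ⟨_, Order.krullDim_eq_length_of_finiteDimensionalOrder⟩
  have hdepth : (e + 1 : ℕ) ≤ depthIn (maximalIdeal R) := by
    rw [← WithBot.coe_le_coe, hR.depth_eq_dim,
      ← ringKrullDim_quotient_span_singleton_succ_eq_ringKrullDim hxreg hx, he]
    exact le_rfl
  rw [he]
  exact WithBot.coe_le_coe.mpr (natCast_le_depthIn_quotient_span_singleton hx hxreg hdepth)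

end Depth

/-! ### Reductions generated by a regular sequence -/

section RegularReduction

open RingTheory.Sequence

theorem infinite_residueField_of_surjective {R S : Type*} [CommRing R] [IsLocalRing R] [CommRing S]
    [IsLocalRing S] [Infinite (ResidueField R)] {f : R →+* S} (hf : Function.Surjective f) :
    Infinite (ResidueField S) :=
  have := hf.isLocalHom f
  Infinite.of_injective (ResidueField.map f) (RingHom.injective _)

theorem isLocalRing_quotient_span_singleton {R : Type*} [CommRing R] [IsLocalRing R] {x : R}
    (hx : x ∈ maximalIdeal R) : IsLocalRing (R ⧸ Ideal.span {x}) :=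
  have : Nontrivial (R ⧸ Ideal.span {x}) := Ideal.Quotient.nontrivial_iff.mpr fun h =>
    (mem_maximalIdeal x).mp hx (Ideal.span_singleton_eq_top.mp h)
  .of_surjective' _ Ideal.Quotient.mk_surjective

theorem IsReduction.of_map_quotient_span_singleton {R : Type*} [CommRing R] {K I : Ideal R} {x : R}
    (hx : x ∈ I) (hKI : K ≤ I)
    (hinf : ∃ c, ∀ n ≥ c, I ^ (n + 1) ⊓ Ideal.span {x} ≤ Ideal.span {x} * I ^ n)
    (hK : IsReduction (K.map (Ideal.Quotient.mk (Ideal.span {x})))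
      (I.map (Ideal.Quotient.mk (Ideal.span {x})))) : IsReduction (Ideal.span {x} ⊔ K) I := by
  obtain ⟨c, hc⟩ := hinf
  have hle : Ideal.span {x} ⊔ K ≤ I := sup_le ((Ideal.span_singleton_le_iff_mem I).mpr hx) hKI
  let n := reductionNumberWrt (K.map (Ideal.Quotient.mk (Ideal.span {x})))
    (I.map (Ideal.Quotient.mk (Ideal.span {x}))) + c
  have hmap : (K * I ^ n).map (Ideal.Quotient.mk (Ideal.span {x})) =
      (I ^ (n + 1)).map (Ideal.Quotient.mk (Ideal.span {x})) := by
    rw [Ideal.map_mul, Ideal.map_pow, Ideal.map_pow]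
    exact hK.mul_pow_eq_of_reductionNumberWrt_le (Nat.le_add_right _ c)
  have hmod : I ^ (n + 1) ≤ K * I ^ n ⊔ Ideal.span {x} := fun a ha =>
    Ideal.mem_quotient_iff_mem_sup.mp (hmap ▸ Ideal.mem_map_of_mem _ ha)
  have hKn : K * I ^ n ≤ I ^ (n + 1) := (Ideal.mul_mono_left hKI).trans (pow_succ' I n).ge
  refine ⟨hle, n, le_antisymm ((Ideal.mul_mono_left hle).trans (pow_succ' I n).ge) ?_⟩
  calc I ^ (n + 1) = (K * I ^ n ⊔ Ideal.span {x}) ⊓ I ^ (n + 1) := (inf_eq_right.mpr hmod).symm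
    _ = K * I ^ n ⊔ I ^ (n + 1) ⊓ Ideal.span {x} := by rw [sup_inf_assoc_of_le _ hKn, inf_comm]
    _ ≤ K * I ^ n ⊔ Ideal.span {x} * I ^ n := sup_le_sup_left (hc n (Nat.le_add_left c _)) _
    _ = (Ideal.span {x} ⊔ K) * I ^ n := by rw [Ideal.sup_mul, sup_comm]

theorem IsSuperficial.exists_isRegular_isReduction_of_quotient {R : Type*} [CommRing R]
    [IsNoetherianRing R] {I : Ideal R} {x : R} (hx : IsSuperficial x I) (hxreg : IsSMulRegular R x)
    {rs' : List (R ⧸ Ideal.span {x})} (hreg : IsRegular (R ⧸ Ideal.span {x}) rs')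
    (hred : IsReduction (Ideal.ofList rs') (I.map (Ideal.Quotient.mk (Ideal.span {x})))) :
    ∃ rs : List R, rs.length = rs'.length + 1 ∧ IsRegular R rs ∧
      IsReduction (Ideal.ofList rs) I := by
  have hlift : ∀ r' ∈ rs', ∃ r ∈ I, Ideal.Quotient.mk (Ideal.span {x}) r = r' := fun r' hr' =>
    (Ideal.mem_map_iff_of_surjective _ Ideal.Quotient.mk_surjective).mp
      (hred.1 (Ideal.subset_span hr'))
  choose! lift hliftI hlift_eq using hlift
  have hrs' : (rs'.map lift).map (Ideal.Quotient.mk (Ideal.span {x})) = rs' := by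
    rw [List.map_map]
    exact (List.map_congr_left hlift_eq).trans (List.map_id rs')
  rw [← hrs', ← Ideal.map_ofList] at hred
  have hle : Ideal.ofList (rs'.map lift) ≤ I :=
    Ideal.span_le.mpr (List.forall_mem_map.mpr hliftI)
  refine ⟨x :: rs'.map lift, by simp,
    (isRegular_cons_iff_quotient_span x _).mpr ⟨hxreg, hrs'.symm ▸ hreg⟩, ?_⟩
  rw [Ideal.ofList_cons]
  exact .of_map_quotient_span_singleton hx.1 hle hx.exists_forall_pow_inf_span_le hred

theorem IsReduction.bot_of_isNilpotent {R : Type*} [CommRing R] {I : Ideal R} (hI : IsNilpotent I) :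
    IsReduction ⊥ I := by
  obtain ⟨n, hn⟩ := hI
  exact ⟨bot_le, n, by simp [pow_succ, show I ^ n = ⊥ from hn]⟩

theorem isNilpotent_of_ringKrullDim_eq_zero {R : Type*} [CommRing R] [IsLocalRing R]
    [IsNoetherianRing R] (hdim : ringKrullDim R = 0) {I : Ideal R} (hI : I ≠ ⊤) :
    IsNilpotent I := by
  have : Ring.KrullDimLE 0 R := Ring.krullDimLE_iff.mpr hdim.le
  have : IsArtinianRing R :=
    isArtinianRing_iff_isNoetherianRing_krullDimLE_zero.mpr ⟨inferInstance, this⟩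
  obtain ⟨n, hn⟩ := IsArtinianRing.isNilpotent_jacobson_bot (R := R)
  rw [jacobson_eq_maximalIdeal ⊥ bot_ne_top] at hn
  exact ⟨n, le_bot_iff.mp ((Ideal.pow_right_mono (le_maximalIdeal hI) n).trans hn.le)⟩

theorem IsCohenMacaulayLocalRing.exists_mem_isSMulRegular {R : Type*} [CommRing R] [IsLocalRing R]
    (hR : IsCohenMacaulayLocalRing R) (hdim : 1 ≤ ringKrullDim R) {I : Ideal R}
    (hI : I.radical = maximalIdeal R) : ∃ y ∈ I, IsSMulRegular R y := by
  rw [← hR.depth_eq_dim] at hdim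
  obtain ⟨rs, hlen, hmem, hreg⟩ := (natCast_le_depthIn_iff (n := 1)).mp (WithBot.coe_le_coe.mp hdim)
  obtain ⟨y, rfl⟩ := List.length_eq_one_iff.mp hlen
  obtain ⟨n, hn⟩ : y ∈ I.radical := hI ▸ hmem y (List.mem_singleton_self y)
  exact ⟨y ^ n, hn, ((isRegular_cons_iff R y []).mp hreg).1.pow n⟩

theorem IsCohenMacaulayLocalRing.exists_isRegular_isReduction {d : ℕ} {R : Type*} [CommRing R]
    [IsLocalRing R] [Infinite (ResidueField R)] (hR : IsCohenMacaulayLocalRing R)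
    (hdim : ringKrullDim R = d) {I : Ideal R} (hI : I.radical = maximalIdeal R) :
    ∃ rs : List R, rs.length = d ∧ IsRegular R rs ∧ IsReduction (Ideal.ofList rs) I := by
  have := hR.isNoetherianRing
  have hIm : I ≤ maximalIdeal R := Ideal.le_radical.trans hI.le
  induction d generalizing R with
  | zero =>
    have hItop : I ≠ ⊤ := fun h => (maximalIdeal.isMaximal R).ne_top (top_le_iff.mp (h ▸ hIm))
    refine ⟨[], rfl, IsRegular.nil R R, ?_⟩
    rw [Ideal.ofList_nil]
    exact .bot_of_isNilpotent (isNilpotent_of_ringKrullDim_eq_zero (by simpa using hdim) hItop)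
  | succ d ih =>
    have hdimpos : 1 ≤ ringKrullDim R := by rw [hdim]; exact_mod_cast d.succ_pos
    obtain ⟨x, hxsup, hxreg⟩ :=
      exists_isSuperficial_isSMulRegular (hR.exists_mem_isSMulRegular hdimpos hI)
    have hxm : x ∈ maximalIdeal R := hIm hxsup.1
    let π := Ideal.Quotient.mk (Ideal.span {x})
    have hπ : Function.Surjective π := Ideal.Quotient.mk_surjective
    have := isLocalRing_quotient_span_singleton hxm
    have := infinite_residueField_of_surjective hπ
    have hdim' : ringKrullDim (R ⧸ Ideal.span {x}) = d := by
      have h := ringKrullDim_quotient_span_singleton_succ_eq_ringKrullDim hxreg hxm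
      rw [hdim, Nat.cast_succ] at h
      exact ENat.WithBot.add_one_cancel.mp h
    have hI' : (I.map π).radical = maximalIdeal (R ⧸ Ideal.span {x}) := by
      rw [← map_maximalIdeal_of_surjective π hπ, ← hI, Ideal.map_radical_of_surjective hπ]
      rw [Ideal.mk_ker]
      exact (Ideal.span_singleton_le_iff_mem I).mpr hxsup.1
    obtain ⟨rs', hlen, hreg, hred⟩ := ih (hR.quotient_span_singleton hxm hxreg) hdim' hI'
      inferInstance (Ideal.le_radical.trans hI'.le)
    exact hlen ▸ hxsup.exists_isRegular_isReduction_of_quotient hxreg hreg hred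

theorem IsMinimalReduction.exists_isRegular_ofList_eq {d : ℕ} {R : Type*} [CommRing R]
    [IsLocalRing R] [Infinite (ResidueField R)] (hR : IsCohenMacaulayLocalRing R)
    (hdim : ringKrullDim R = d) {I J : Ideal R} (hI : I.radical = maximalIdeal R)
    (hJ : IsMinimalReduction J I) :
    ∃ rs : List R, rs.length = d ∧ IsRegular R rs ∧ Ideal.ofList rs = J := by
  obtain ⟨rs, hlen, hreg, hred⟩ :=
    hR.exists_isRegular_isReduction hdim (hJ.prop.radical_eq.trans hI)
  exact ⟨rs, hlen, hreg, hred.1.antisymm (hJ.le_of_le (hred.trans hJ.prop) hred.1)⟩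

end RegularReduction

/-! ### The criterion of Valabrega and Valla -/

section ValabregaValla

open RingTheory.Sequence

variable {R : Type*} [CommRing R] {I L : Ideal R} {x : R}

theorem ofList_take_succ (rs : List R) {i : ℕ} (h : i < rs.length) :
    Ideal.ofList (rs.take (i + 1)) = Ideal.ofList (rs.take i) ⊔ Ideal.span {rs[i]} := by
  rw [← List.take_concat_get' rs i h, Ideal.ofList_append, Ideal.ofList_singleton]

theorem isWeaklyRegular_self_iff (rs : List R) :
    IsWeaklyRegular R rs ↔ ∀ i (h : i < rs.length), ∀ a,
      rs[i] * a ∈ Ideal.ofList (rs.take i) → a ∈ Ideal.ofList (rs.take i) := by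
  simp only [isWeaklyRegular_iff, isSMulRegular_quotient_iff_mem_of_smul_mem, smul_eq_mul,
    Ideal.mul_top]

/-- The condition `Iⁿ⁺¹ ∩ L = Iⁿ L` for all `n` of Valabrega and Valla, where `L ⊆ I`. Only the
inclusion that can fail is recorded. -/
def ValabregaVallaCondition (I L : Ideal R) : Prop :=
  ∀ n, I ^ (n + 1) ⊓ L ≤ L * I ^ n

theorem ValabregaVallaCondition.of_mul_eq_sq {J : Ideal R} (h : J * I = I ^ 2) :
    ValabregaVallaCondition I J
  | 0 => by simp
  | n + 1 => by
    rw [pow_succ' I n, ← mul_assoc, h, ← pow_add, add_comm 2 n]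
    exact inf_le_left

theorem ValabregaVallaCondition.of_sup_span_singleton (hx : x ∈ I)
    (hreg : ∀ a, x * a ∈ L → a ∈ L) (h : ValabregaVallaCondition I (L ⊔ Ideal.span {x})) :
    ValabregaVallaCondition I L := by
  intro n
  induction n with
  | zero => simp
  | succ n ih =>
    rintro a ⟨haI, haL⟩
    have ha := h (n + 1) ⟨haI, Ideal.mem_sup_left haL⟩
    rw [Ideal.sup_mul] at ha
    obtain ⟨u, hu, v, hv, rfl⟩ := Submodule.mem_sup.mp ha
    obtain ⟨b, hb, rfl⟩ := Ideal.mem_span_singleton_mul.mp hv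
    have hbL : b ∈ L := hreg b ((add_mem_cancel_left (Ideal.mul_le_left hu)).mp haL)
    refine Ideal.add_mem _ hu ?_
    rw [pow_succ, ← mul_assoc, mul_comm x]
    exact Ideal.mul_mem_mul (ih ⟨hb, hbL⟩) hx

theorem ValabregaVallaCondition.ofList_take {rs : List R} (hmem : ∀ r ∈ rs, r ∈ I)
    (hreg : IsWeaklyRegular R rs) (h : ValabregaVallaCondition I (Ideal.ofList rs)) {i : ℕ}
    (hi : i ≤ rs.length) : ValabregaVallaCondition I (Ideal.ofList (rs.take i)) := by
  induction hi using Nat.decreasingInduction with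
  | self => rwa [List.take_length]
  | of_succ i hi ih =>
    rw [ofList_take_succ rs hi] at ih
    exact ih.of_sup_span_singleton (hmem _ (List.getElem_mem hi))
      ((isWeaklyRegular_self_iff rs).mp hreg i hi)

theorem ValabregaVallaCondition.mem_of_mul_mem (hreg : ∀ a, x * a ∈ L → a ∈ L)
    (h : ValabregaVallaCondition I (L ⊔ Ideal.span {x})) {n : ℕ} {a : R} (ha : a ∈ I ^ n)
    (hxa : x * a ∈ L ⊓ I ^ (n + 1) ⊔ I ^ (n + 2)) : a ∈ L ⊓ I ^ n ⊔ I ^ (n + 1) := by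
  obtain ⟨u, ⟨huL, -⟩, v, hv, huv⟩ := Submodule.mem_sup.mp hxa
  have hvL : v ∈ L ⊔ Ideal.span {x} := by
    rw [← add_sub_cancel_left u v, huv]
    exact Ideal.sub_mem _
      (Ideal.mem_sup_right (Ideal.mul_mem_right _ _ (Ideal.mem_span_singleton_self x)))
      (Ideal.mem_sup_left huL)
  have hv' := h (n + 1) ⟨hv, hvL⟩
  rw [Ideal.sup_mul] at hv'
  obtain ⟨w, hw, z, hz, rfl⟩ := Submodule.mem_sup.mp hv'
  obtain ⟨c, hc, rfl⟩ := Ideal.mem_span_singleton_mul.mp hz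
  have hacL : a - c ∈ L := by
    refine hreg _ ?_
    rw [show x * (a - c) = u + w by linear_combination -huv]
    exact Ideal.add_mem _ huL (Ideal.mul_le_left hw)
  have hacI : a - c ∈ I ^ n := Ideal.sub_mem _ ha (Ideal.pow_le_pow_right n.le_succ hc)
  exact Submodule.mem_sup.mpr ⟨a - c, ⟨hacL, hacI⟩, c, hc, sub_add_cancel a c⟩

theorem pow_mul_inf_sup_pow_le (I L : Ideal R) (j k : ℕ) :
    I ^ j * (L ⊓ I ^ k ⊔ I ^ (k + 1)) ≤ L ⊓ I ^ (j + k) ⊔ I ^ (j + k + 1) := by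
  have hL : I ^ j * (L ⊓ I ^ k) ≤ L ⊓ I ^ (j + k) :=
    le_inf (Ideal.mul_le_right.trans inf_le_left)
      (pow_add I j k ▸ Ideal.mul_mono_right inf_le_right)
  rw [Ideal.mul_sup, add_assoc j k 1, pow_add I j (k + 1)]
  exact sup_le_sup_right hL _

/-- The preimage in the Rees algebra of `I` of the ideal of `gr(I)` consisting of the initial forms
of the elements of `L`, that is, the kernel of `gr(I) → gr((I + L) / L)`. -/
noncomputable def reesInitialIdeal (I L : Ideal R) : Ideal (reesAlgebra I) where
  carrier := {f | ∀ n, (f : R[X]).coeff n ∈ L ⊓ I ^ n ⊔ I ^ (n + 1)}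
  add_mem' hf hg n := by
    simpa using Ideal.add_mem _ (hf n) (hg n)
  zero_mem' n := by simp
  smul_mem' c f hf n := by
    simp only [smul_eq_mul, MulMemClass.coe_mul, coeff_mul]
    refine Ideal.sum_mem _ ?_
    rintro ⟨j, k⟩ e
    rw [← Finset.HasAntidiagonal.mem_antidiagonal.mp e]
    exact pow_mul_inf_sup_pow_le I L j k (Ideal.mul_mem_mul (c.2 j) (hf k))

theorem ofList_map_val_le (xs : List I) : Ideal.ofList (xs.map Subtype.val) ≤ I :=
  Ideal.span_le.mpr (List.forall_mem_map.mpr fun y _ => y.2)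

theorem ofList_reesDegreeOne_sup_reesShift {xs : List I}
    (h : ValabregaVallaCondition I (Ideal.ofList (xs.map Subtype.val))) :
    Ideal.ofList (xs.map (reesDegreeOne I)) ⊔ reesShift I =
      reesInitialIdeal I (Ideal.ofList (xs.map Subtype.val)) := by
  refine le_antisymm (sup_le (Ideal.span_le.mpr (List.forall_mem_map.mpr fun y hy n => ?_))
    fun f hf n => Ideal.mem_sup_right (hf n)) fun f hf => mem_of_forall_coeff_mem_reesPiece ?_
  · rw [coe_reesDegreeOne, coeff_monomial]
    split_ifs with hn
    · subst hn
      exact Ideal.mem_sup_left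
        ⟨Ideal.subset_span (List.mem_map_of_mem hy), by rw [pow_one]; exact y.2⟩
    · exact zero_mem _
  set T := Ideal.ofList (xs.map (reesDegreeOne I)) ⊔ reesShift I
  set L := Ideal.ofList (xs.map Subtype.val)
  have hshift (n : ℕ) : I ^ (n + 1) ≤ reesPiece T n :=
    (reesPiece_reesShift I n).ge.trans (reesPiece_mono le_sup_right n)
  have hL : L ≤ reesPiece T 1 := Ideal.span_le.mpr <| List.forall_mem_map.mpr fun y hy =>
    ⟨reesDegreeOne I y, Ideal.mem_sup_left (Ideal.subset_span (List.mem_map_of_mem hy)), rfl⟩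
  have hLinf : ∀ n, L ⊓ I ^ n ≤ reesPiece T n
    | 0 => inf_le_left.trans ((ofList_map_val_le xs).trans ((pow_one I).ge.trans (hshift 0)))
    | n + 1 => calc
        L ⊓ I ^ (n + 1) ≤ L * I ^ n := inf_comm L _ ▸ h n
        _ ≤ reesPiece T 1 * I ^ n := Ideal.mul_mono_left hL
        _ ≤ reesPiece T (n + 1) := add_comm 1 n ▸ reesPiece_mul_pow_le T 1 n
  exact fun n => sup_le (hLinf n) (hshift n) (hf n)

theorem ValabregaVallaCondition.mk_mem_ofList_iff {xs : List I}
    (h : ValabregaVallaCondition I (Ideal.ofList (xs.map Subtype.val))) (f : reesAlgebra I) :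
    Ideal.Quotient.mk (reesShift I) f ∈
        Ideal.ofList ((xs.map (reesDegreeOne I)).map (Ideal.Quotient.mk (reesShift I))) ↔
      f ∈ reesInitialIdeal I (Ideal.ofList (xs.map Subtype.val)) := by
  rw [← Ideal.map_ofList, Ideal.mem_quotient_iff_mem_sup, ofList_reesDegreeOne_sup_reesShift h]

theorem nontrivial_assocGraded (hI : I ≠ ⊤) : Nontrivial (AssocGraded I) := by
  refine Ideal.Quotient.nontrivial_iff.mpr fun h => hI ((Ideal.eq_top_iff_one I).mpr ?_)
  simpa using (show (1 : reesAlgebra I) ∈ reesShift I from h ▸ Submodule.mem_top) 0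

theorem isWeaklyRegular_initialForms {xs : List I}
    (hreg : IsWeaklyRegular R (xs.map Subtype.val))
    (h : ValabregaVallaCondition I (Ideal.ofList (xs.map Subtype.val))) :
    IsWeaklyRegular (AssocGraded I)
      ((xs.map (reesDegreeOne I)).map (Ideal.Quotient.mk (reesShift I))) := by
  have htake {i : ℕ} (hi : i ≤ xs.length) :
      ValabregaVallaCondition I (Ideal.ofList ((xs.take i).map Subtype.val)) := by
    rw [List.map_take]
    exact h.ofList_take (List.forall_mem_map.mpr fun y _ => y.2) hreg (by simpa using hi)
  refine (isWeaklyRegular_self_iff _).mpr fun i hi a ha => ?_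
  obtain ⟨f, rfl⟩ := Ideal.Quotient.mk_surjective a
  have hi' : i < xs.length := by simpa using hi
  rw [List.getElem_map, List.getElem_map, ← map_mul, ← List.map_take, ← List.map_take,
    (htake hi'.le).mk_mem_ofList_iff] at ha
  rw [← List.map_take, ← List.map_take, (htake hi'.le).mk_mem_ofList_iff]
  have hsucc := htake (Nat.succ_le_of_lt hi')
  rw [List.map_take, ofList_take_succ _ (by simpa using hi')] at hsucc
  intro n
  have hcoeff : ((reesDegreeOne I xs[i] * f : reesAlgebra I) : R[X]).coeff (n + 1) =
      (xs[i] : R) * (f : R[X]).coeff n := by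
    simp [coe_reesDegreeOne, ← C_mul_X_eq_monomial, mul_assoc]
  rw [List.map_take] at ha ⊢
  refine hsucc.mem_of_mul_mem ((isWeaklyRegular_self_iff _).mp hreg i (by simpa using hi'))
    (f.2 n) ?_
  rw [List.getElem_map, ← hcoeff]
  exact ha (n + 1)

theorem ValabregaVallaCondition.length_le_depthGr [IsLocalRing R] (hI : I ≠ ⊤) {rs : List R}
    (hmem : ∀ r ∈ rs, r ∈ I) (hreg : IsWeaklyRegular R rs)
    (h : ValabregaVallaCondition I (Ideal.ofList rs)) : rs.length ≤ depthGr I := by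
  lift rs to List I using hmem
  have := nontrivial_assocGraded hI
  have hmax : ∀ t ∈ (rs.map (reesDegreeOne I)).map (Ideal.Quotient.mk (reesShift I)),
      t ∈ (reesMaximalIdeal I).map (Ideal.Quotient.mk (reesShift I)) := by
    simp only [List.forall_mem_map]
    intro y _
    refine Ideal.mem_map_of_mem _ ?_
    simp [reesMaximalIdeal, coe_reesDegreeOne, coeff_monomial]
  have hone : (1 : AssocGraded I) ∉
      Ideal.ofList ((rs.map (reesDegreeOne I)).map (Ideal.Quotient.mk (reesShift I))) := by
    intro hmem
    rw [← map_one (Ideal.Quotient.mk (reesShift I)), h.mk_mem_ofList_iff] at hmem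
    have hcoeff := hmem 0
    rw [OneMemClass.coe_one, coeff_one_zero, zero_add, pow_one] at hcoeff
    exact hI ((Ideal.eq_top_iff_one I).mpr
      (sup_le (inf_le_left.trans (ofList_map_val_le rs)) le_rfl hcoeff))
  refine natCast_le_depthIn_iff.mpr
    ⟨_, by simp, hmax, isWeaklyRegular_initialForms hreg h, fun htop => hone ?_⟩
  rw [smul_eq_mul, Ideal.mul_top] at htop
  exact htop ▸ Submodule.mem_top

end ValabregaValla

/-! ### Reduction number at most one -/

theorem natCast_le_depthGr_of_reductionNumber_le_one {R : Type*} [CommRing R] [IsLocalRing R]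
    [Infinite (ResidueField R)] (hR : IsCohenMacaulayLocalRing R) {d : ℕ}
    (hdim : ringKrullDim R = d) {I : Ideal R} (hI : IsMaximalPrimary I)
    (hrd : reductionNumber I ≤ 1) : d ≤ depthGr I := by
  have := hR.isNoetherianRing
  obtain ⟨J, hJ, hrdJ⟩ := exists_isMinimalReduction_reductionNumber_eq I
  have hJI : J * I = I ^ 2 := by
    simpa using hJ.prop.mul_pow_eq_of_reductionNumberWrt_le (n := 1) (hrdJ ▸ hrd)
  obtain ⟨rs, rfl, hreg, rfl⟩ := hJ.exists_isRegular_ofList_eq hR hdim hI.2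
  have hmem : ∀ r ∈ rs, r ∈ I := fun r hr => hJ.prop.1 (Ideal.subset_span hr)
  exact (ValabregaVallaCondition.of_mul_eq_sq hJI).length_le_depthGr hI.1.ne_top hmem
    hreg.toIsWeaklyRegular

theorem proposition3p14_general {R : Type*} [CommRing R] [IsLocalRing R]
    [Infinite (ResidueField R)] (hR : IsCohenMacaulayLocalRing R) {d : ℕ}
    (hdim : ringKrullDim R = d) {I : Ideal R} (hI : IsMaximalPrimary I) (hdepth : depthGr I < d)
    (hn : postulationNumber I < -((d : ℤ) - 3)) :
    postulationNumber I + d ≤ reductionNumber I := by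
  have hrd : 1 < reductionNumber I := by
    by_contra! hle
    exact hdepth.not_ge (natCast_le_depthGr_of_reductionNumber_le_one hR hdim hI hle)
  linarith [show (2 : ℤ) ≤ reductionNumber I from mod_cast hrd]

theorem proposition3p14 {R : Type*} [CommRing R] [IsLocalRing R]
    [Infinite (IsLocalRing.ResidueField R)]
    (hCM : IsCohenMacaulayLocalRing R)
    (d : ℕ) (hd : 3 ≤ d) (hdim : ringKrullDim R = d)
    (I : Ideal R) (hI : IsMaximalPrimary I)
    (hdepth : depthGr I = ((d - 2 : ℕ) : ℕ∞))
    (hn : postulationNumber I < -((d : ℤ) - 3)) :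
    postulationNumber I + (d : ℤ) ≤ (reductionNumber I : ℤ) :=
  proposition3p14_general hCM hdim hI (hdepth.trans_lt (by norm_cast; omega)) hn
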